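/- Let $m,n\ge 1$ and consider the linear program $$R_n^*=\max\Big\{\sum_{j=1}^n r_jx_j:\ \sum_{j=1}^n \bm a_j x_j\le \bm b,\ 0\le x_j\le 1\ (j=1,\dots,n)\Big\},\qquad r_j\in\mathbb R,\ \bm a_j\in\mathbb R^m,\ \bm b=n\bm d,\ \bm d\in\mathbb R^m.$$ Assume that $|r_j|\le\bar r$ and $\|\bm a_j\|_\infty\le\bar a$ for all $j$, that $0<\underline d\le d_i\le\bar d$ for all $i$, and that the data are in general position: for every price vector $\bm p\ge\bm 0$ at most $m$ columns $j$ satisfy $\bm a_j^\top\bm p=r_j$. The pairs $(r_j,\bm a_j)$ arrive in a uniformly random order $\sigma$ (pair $\sigma(t)$ arrives at time $t$). At each time $t=1,\dots,n$ the primal-beats-dual algorithm takes an optimal solution $\tilde{\bm x}^{(t)}$ of the scaled LP on the set $S_t=\{\sigma(1),\dots,\sigma(t)\}$ of columns revealed so far, $$\max\ \sum_{j\in S_t}r_jx_j\quad\text{s.t.}\quad \sum_{j\in S_t}a_{ij}x_j\le t\,d_i\ (i=1,\dots,m),\qquad 0\le x_j\le 1\ (j\in S_t),$$ where, if there are several optimal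 solutions, the choice depends only on the set $S_t$ and not on the order in which its elements arrived; then, with fresh independent randomness, it sets $x_t=1$ with probability $\tilde x^{(t)}_{\sigma(t)}$ and $x_t=0$ otherwise. Let $R_n=\sum_{t=1}^n r_{\sigma(t)}x_t$ be the objective value and $v(\bm x)=\big\|\big(\sum_{t=1}^n\bm a_{\sigma(t)}x_t-\bm b\big)^+\big\|_2$ the constraint violation of the output. Then there is a constant $C>0$ depending only on $\bar r,\bar a,\underline d,\bar d$ such that, for all $m,n\ge1$, all such data and all such choices of optimal solutions, $$R_n^*-\mathbb E[R_n]\le C\sqrt{mn},$$ and, if $n\ge 2$, $$\mathbb E[v(\bm x)]\le C\sqrt{mn}\,\log n,$$ where the expectations are over the random order and the random rounding. -/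

import Mathlib

/-- The data of an online linear program with `m` resource constraints and `n` columns:
rewards `r j`, columns `a j` (so `a j i` is the entry in row `i`), and the vector `d` of
per-period resource levels; the right-hand side is `b = n d`. -/
structure OnlineLP (m n : ℕ) where
  r : Fin n → ℝ
  a : Fin n → Fin m → ℝ
  d : Fin m → ℝ

namespace OnlineLP

noncomputable section

variable {m n : ℕ}

/-- The right-hand side `b = n d`. -/
def rhs (P : OnlineLP m n) (i : Fin m) : ℝ := (n : ℝ) * P.d i

/-- Feasible set of the LP relaxation: `A x ≤ b`, `0 ≤ x ≤ 1`. -/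
def primalFeasible (P : OnlineLP m n) : Set (Fin n → ℝ) :=
  {x | (∀ j, 0 ≤ x j ∧ x j ≤ 1) ∧ ∀ i, ∑ j, P.a j i * x j ≤ P.rhs i}

/-- `R_n^*`, the optimal value of the LP relaxation. -/
def primalValue (P : OnlineLP m n) : ℝ :=
  sSup ((fun x : Fin n → ℝ => ∑ j, P.r j * x j) '' P.primalFeasible)

/-- Boundedness: `|r_j| ≤ rbar`, `‖a_j‖_∞ ≤ abar`, `dlow ≤ d_i ≤ dbar`. -/
structure Bounded (P : OnlineLP m n) (rbar abar dlow dbar : ℝ) : Prop where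
  reward : ∀ j, |P.r j| ≤ rbar
  column : ∀ j i, |P.a j i| ≤ abar
  d_lower : ∀ i, dlow ≤ P.d i
  d_upper : ∀ i, P.d i ≤ dbar

/-- General position: for any price vector `p ≥ 0`, at most `m` columns satisfy `a_jᵀ p = r_j`. -/
def GeneralPosition (P : OnlineLP m n) : Prop :=
  ∀ p : Fin m → ℝ, (∀ i, 0 ≤ p i) → {j : Fin n | ∑ i, P.a j i * p i = P.r j}.ncard ≤ m

/-- Feasibility for the scaled LP on a set `S` of columns: `0 ≤ x_j ≤ 1` for `j ∈ S` and
`∑_{j ∈ S} a_{ij} x_j ≤ |S| d_i` for all `i`. Coordinates outside `S` play no role. -/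
def ScaledFeasible (P : OnlineLP m n) (S : Finset (Fin n)) (x : Fin n → ℝ) : Prop :=
  (∀ j ∈ S, 0 ≤ x j ∧ x j ≤ 1) ∧ ∀ i, ∑ j ∈ S, P.a j i * x j ≤ (S.card : ℝ) * P.d i

/-- `x` is an optimal solution of the scaled LP on the columns in `S`. -/
def IsScaledOptimal (P : OnlineLP m n) (S : Finset (Fin n)) (x : Fin n → ℝ) : Prop :=
  P.ScaledFeasible S x ∧
    ∀ y, P.ScaledFeasible S y → ∑ j ∈ S, P.r j * y j ≤ ∑ j ∈ S, P.r j * x j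

/-- An LP solver for the scaled LPs: it returns an optimal solution for every set of columns.
What it returns is determined by the set of columns, not by the order in which they arrived. -/
def IsSolver (P : OnlineLP m n) (sol : Finset (Fin n) → Fin n → ℝ) : Prop :=
  ∀ S, P.IsScaledOptimal S (sol S)

/-- The columns revealed up to and including time `t` if column `σ s` arrives at time `s`. -/
def revealed (σ : Equiv.Perm (Fin n)) (t : Fin n) : Finset (Fin n) :=
  (Finset.Iic t).map σ.toEmbedding

/-- The entry of the scaled LP solution at time `t` that belongs to the column arriving at `t`. -/
def fraction (sol : Finset (Fin n) → Fin n → ℝ) (σ : Equiv.Perm (Fin n)) (t : Fin n) : ℝ :=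
  sol (revealed σ t) (σ t)

/-- The probability that the columns arrive in the order `σ` and that the primal-beats-dual
algorithm outputs the binary vector `x` (`x t` is the decision at time `t`): `σ` is a uniform
random permutation and, given `σ`, the decisions are rounded independently, the one at time `t`
being `1` with probability `fraction sol σ t` and `0` otherwise. -/
def runProb (sol : Finset (Fin n) → Fin n → ℝ) (σ : Equiv.Perm (Fin n)) (x : Fin n → Bool) : ℝ :=
  (Fintype.card (Equiv.Perm (Fin n)) : ℝ)⁻¹ *
    ∏ t, (if x t then fraction sol σ t else 1 - fraction sol σ t)

/-- Expectation over the random arrival order and the random rounding. -/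
def runExpect (sol : Finset (Fin n) → Fin n → ℝ)
    (f : Equiv.Perm (Fin n) → (Fin n → Bool) → ℝ) : ℝ :=
  ∑ σ : Equiv.Perm (Fin n), ∑ x : Fin n → Bool, runProb sol σ x * f σ x

/-- A binary decision as a real number. -/
def bit (c : Bool) : ℝ := if c then 1 else 0

/-- `R_n`, the objective value of the output `x` under the arrival order `σ`. -/
def reward (P : OnlineLP m n) (σ : Equiv.Perm (Fin n)) (x : Fin n → Bool) : ℝ :=
  ∑ t, P.r (σ t) * bit (x t)

/-- The constraint violation `‖(A x - b)⁺‖₂` of the output `x` under the arrival order `σ`. -/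
def violation (P : OnlineLP m n) (σ : Equiv.Perm (Fin n)) (x : Fin n → Bool) : ℝ :=
  ‖(WithLp.toLp 2 (fun i => max (∑ t, P.a (σ t) i * bit (x t) - P.rhs i) 0) :
    EuclideanSpace ℝ (Fin m))‖

end

end OnlineLP

/-! Given the set of columns revealed up to time `t`, the column that arrives at time `t` is
uniform on that set. The expected reward at time `t` is therefore the mean optimal value, per
column, of the LP restricted to a uniformly random set of `t` columns. An optimal solution of the
full LP, restricted to this set, exceeds the per-column budget `d` only by a sampling error of
expected Euclidean norm `O(√(m / t))`; scaling it down makes it feasible at a proportional loss of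
reward, and `∑ t, √(m / t) = O(√(m n))`.

For the violation, subtract from the use of each resource at time `t` its conditional mean given the
revealed set, which is at most `d i`. The column arriving at an earlier time is uniform on its own
revealed set even given everything that happens later, so these deviations are uncorrelated and
their sum has second moment `O(n)` for each of the `m` resources. -/

section FiniteMeans

open Finset
open scoped BigOperators

variable {ι : Type*}

theorem sum_sum_le_sum_diag_of_offDiag_nonpos {M : Type*} [AddCommMonoid M] [PartialOrder M]
    [IsOrderedAddMonoid M] (s : Finset ι) {K : ι → ι → M}
    (hK : ∀ i ∈ s, ∀ j ∈ s, i ≠ j → K i j ≤ 0) :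
    ∑ i ∈ s, ∑ j ∈ s, K i j ≤ ∑ i ∈ s, K i i := by
  classical
  refine sum_le_sum fun i hi => ?_
  rw [← add_sum_erase _ _ hi]
  exact add_le_of_nonpos_right (sum_nonpos fun j hj =>
    hK i hi j (mem_of_mem_erase hj) (ne_of_mem_erase hj).symm)

theorem expect_sub_expect_sq_le (s : Finset ι) (f : ι → ℝ) :
    𝔼 i ∈ s, (f i - 𝔼 j ∈ s, f j) ^ 2 ≤ 𝔼 i ∈ s, f i ^ 2 := by
  rcases s.eq_empty_or_nonempty with rfl | hs
  · simp only [expect_empty, le_refl]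
  · calc 𝔼 i ∈ s, (f i - 𝔼 j ∈ s, f j) ^ 2
        = 𝔼 i ∈ s, f i ^ 2 - (𝔼 i ∈ s, f i) ^ 2 := by
          simp only [sub_sq, expect_add_distrib, expect_sub_distrib, ← expect_mul, ← mul_expect,
            expect_const hs]
          ring
      _ ≤ 𝔼 i ∈ s, f i ^ 2 := sub_le_self _ (sq_nonneg _)

theorem expect_le_sqrt_expect_sq (s : Finset ι) (f : ι → ℝ) :
    𝔼 i ∈ s, f i ≤ √(𝔼 i ∈ s, f i ^ 2) := by
  rcases s.eq_empty_or_nonempty with rfl | hs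
  · simp only [expect_empty, Real.sqrt_zero, le_refl]
  · refine Real.le_sqrt_of_sq_le ?_
    simpa only [mul_one, one_pow, expect_const hs] using expect_mul_sq_le_sq_mul_sq s f fun _ => 1

theorem le_sqrt_sum_sq {s : Finset ι} {i : ι} (hi : i ∈ s) (f : ι → ℝ) :
    f i ≤ √(∑ j ∈ s, f j ^ 2) :=
  Real.le_sqrt_of_sq_le (single_le_sum (f := fun j => f j ^ 2) (fun _ _ => sq_nonneg _) hi)

theorem sum_mul_le_sqrt_sum_mul_sq {s : Finset ι} {w : ι → ℝ} (hw : ∀ i ∈ s, 0 ≤ w i)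
    (hw_sum : ∑ i ∈ s, w i = 1) (f : ι → ℝ) :
    ∑ i ∈ s, w i * f i ≤ √(∑ i ∈ s, w i * f i ^ 2) :=
  Real.le_sqrt_of_sq_le (Real.pow_arith_mean_le_arith_mean_pow_of_even s w f hw hw_sum even_two)

theorem sum_bernoulli_mul_prod [Fintype ι] [DecidableEq ι] (q : ι → ℝ) (T : Finset ι)
    (g : ι → Bool → ℝ) :
    ∑ x : ι → Bool, (∏ t, if x t then q t else 1 - q t) * ∏ t ∈ T, g t (x t) =
      ∏ t ∈ T, (q t * g t true + (1 - q t) * g t false) := by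
  calc ∑ x : ι → Bool, (∏ t, if x t then q t else 1 - q t) * ∏ t ∈ T, g t (x t)
      = ∑ x : ι → Bool, ∏ t, (if x t then q t else 1 - q t) *
          (if t ∈ T then g t (x t) else 1) := by
        simp only [← Fintype.prod_ite_mem T, prod_mul_distrib]
    _ = ∏ t, ∑ b : Bool, (if b then q t else 1 - q t) * (if t ∈ T then g t b else 1) :=
        (Fintype.prod_sum fun t (b : Bool) =>
          (if b then q t else 1 - q t) * (if t ∈ T then g t b else 1)).symm
    _ = ∏ t, (if t ∈ T then q t * g t true + (1 - q t) * g t false else 1) := by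
        refine prod_congr rfl fun t _ => ?_
        split_ifs <;> simp
    _ = _ := Fintype.prod_ite_mem T _

theorem le_two_mul_mul_log {a x : ℝ} (ha : 0 ≤ a) (hx : 2 ≤ x) : a ≤ 2 * (a * Real.log x) := by
  have hlog : 1 ≤ 2 * Real.log x := by
    linarith [Real.log_two_gt_d9, Real.log_le_log two_pos hx]
  linarith [mul_le_mul_of_nonneg_left hlog ha]

theorem sum_fin_inv_sqrt_le (n : ℕ) : ∑ t : Fin n, (√((t : ℝ) + 1))⁻¹ ≤ 2 * √n := by
  induction n with
  | zero => simp
  | succ k ih =>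
    have hk : √(k : ℝ) ^ 2 = k := Real.sq_sqrt k.cast_nonneg
    have hk_succ : √((k : ℝ) + 1) ^ 2 = k + 1 := Real.sq_sqrt (by positivity)
    have telescope : (√((k : ℝ) + 1))⁻¹ ≤ 2 * (√((k : ℝ) + 1) - √k) := by
      rw [inv_le_iff_one_le_mul₀ (by positivity)]
      nlinarith [sq_nonneg (√((k : ℝ) + 1) - √k)]
    rw [Fin.sum_univ_castSucc]
    simp only [Fin.val_castSucc, Fin.val_last]
    push_cast
    linarith

end FiniteMeans

section UniformPermutation

open Finset
open scoped BigOperators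

variable {α : Type*} [Fintype α] [DecidableEq α] {T : Finset α}

-- Right multiplication by `Equiv.swap b a` preserves the uniform measure, so the positions in `T`
-- are exchangeable for every `G` that does not see these swaps.
theorem expect_perm_eq_expect_expect {M : Type*} [AddCommMonoid M] [Module ℚ≥0 M] {a : α}
    (ha : a ∈ T) {G : Equiv.Perm α → α → M}
    (hG : ∀ b ∈ T, ∀ σ, G (σ * Equiv.swap b a) = G σ) :
    𝔼 σ, G σ (σ a) = 𝔼 σ, 𝔼 b ∈ T, G σ (σ b) := by
  have swap_eq : ∀ b ∈ T, 𝔼 σ, G σ (σ b) = 𝔼 σ, G σ (σ a) := fun b hb =>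
    (Fintype.expect_equiv (Equiv.mulRight (Equiv.swap b a)) _ _ fun σ => by
      simp [hG b hb]).symm
  rw [expect_comm, expect_congr rfl swap_eq, expect_const ⟨a, ha⟩]

theorem expect_perm_apply {M : Type*} [AddCommMonoid M] [Module ℚ≥0 M] (f : α → M) (a : α) :
    𝔼 σ : Equiv.Perm α, f (σ a) = 𝔼 b, f b := by
  rw [expect_perm_eq_expect_expect (mem_univ a) (G := fun _ => f) fun _ _ _ => rfl,
    expect_congr rfl fun σ _ => Fintype.expect_equiv σ _ f fun _ => rfl, Fintype.expect_const]

theorem expect_perm_expect {M : Type*} [AddCommMonoid M] [Module ℚ≥0 M] (hT : T.Nonempty)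
    (f : α → M) : 𝔼 σ : Equiv.Perm α, 𝔼 a ∈ T, f (σ a) = 𝔼 b, f b := by
  rw [expect_comm, expect_congr rfl fun a _ => expect_perm_apply f a, expect_const hT]

theorem expect_perm_mul_nonpos {u : α → ℝ} (hu : ∑ b, u b = 0) {a b : α} (hab : a ≠ b) :
    𝔼 σ : Equiv.Perm α, u (σ a) * u (σ b) ≤ 0 := by
  have hb : b ∈ univ.erase a := mem_erase.2 ⟨hab.symm, mem_univ b⟩
  have rest_eq (σ : Equiv.Perm α) : ∑ c ∈ univ.erase a, u (σ c) = -u (σ a) := by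
    rw [sum_erase_eq_sub (mem_univ a), Equiv.sum_comp σ u, hu, zero_sub]
  rw [expect_perm_eq_expect_expect hb (G := fun σ j => u (σ a) * u j) fun c hc σ => by
    simp [Equiv.swap_apply_of_ne_of_ne (ne_of_mem_erase hc).symm hab]]
  refine (expect_le_expect fun σ _ => ?_).trans_eq (expect_const_zero univ)
  rw [← mul_expect, expect_eq_sum_div_card, rest_eq, mul_div_assoc', mul_neg]
  exact div_nonpos_of_nonpos_of_nonneg (neg_nonpos.2 (mul_self_nonneg _)) (Nat.cast_nonneg _)

theorem expect_perm_sum_sq_le {u : α → ℝ} (hu : ∑ b, u b = 0) (T : Finset α) :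
    𝔼 σ : Equiv.Perm α, (∑ a ∈ T, u (σ a)) ^ 2 ≤ #T * 𝔼 b, u b ^ 2 := by
  simp only [sq, sum_mul_sum, expect_sum_comm]
  refine (sum_sum_le_sum_diag_of_offDiag_nonpos T fun a _ b _ hab =>
    expect_perm_mul_nonpos hu hab).trans_eq ?_
  rw [sum_congr rfl fun a _ => expect_perm_apply (fun b => u b * u b) a, sum_const, nsmul_eq_mul]

theorem expect_perm_expect_sub_expect_sq_le (hT : T.Nonempty) (c : α → ℝ) :
    𝔼 σ : Equiv.Perm α, (𝔼 a ∈ T, c (σ a) - 𝔼 b, c b) ^ 2 ≤ (𝔼 b, c b ^ 2) / #T := by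
  have hcard : (0 : ℝ) < #T := by exact_mod_cast hT.card_pos
  have hα : (univ : Finset α).Nonempty := hT.mono (subset_univ T)
  set u : α → ℝ := fun b => c b - 𝔼 b, c b
  have hu : ∑ b, u b = 0 := by
    rw [← Fintype.card_mul_expect, expect_sub_distrib, expect_const hα, sub_self, mul_zero]
  have mean_eq (σ : Equiv.Perm α) :
      (𝔼 a ∈ T, c (σ a) - 𝔼 b, c b) ^ 2 = (∑ a ∈ T, u (σ a)) ^ 2 / (#T : ℝ) ^ 2 := by
    rw [← div_pow, ← expect_eq_sum_div_card, expect_sub_distrib, expect_const hT]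
  calc 𝔼 σ : Equiv.Perm α, (𝔼 a ∈ T, c (σ a) - 𝔼 b, c b) ^ 2
      = (𝔼 σ : Equiv.Perm α, (∑ a ∈ T, u (σ a)) ^ 2) / (#T : ℝ) ^ 2 := by
        simp only [mean_eq, expect_div]
    _ ≤ #T * (𝔼 b, c b ^ 2) / (#T : ℝ) ^ 2 := by
        gcongr
        exact (expect_perm_sum_sq_le hu T).trans
          (mul_le_mul_of_nonneg_left (expect_sub_expect_sq_le univ c) hcard.le)
    _ = (𝔼 b, c b ^ 2) / #T := by field_simp

theorem expect_perm_sqrt_sum_sq_le {κ : Type*} [Fintype κ] {c : κ → α → ℝ} {B : ℝ} (hB : 0 ≤ B)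
    (hc : ∀ i b, |c i b| ≤ B) (hT : T.Nonempty) :
    𝔼 σ : Equiv.Perm α, √(∑ i, (𝔼 a ∈ T, c i (σ a) - 𝔼 b, c i b) ^ 2) ≤
      B * √(Fintype.card κ / #T) := by
  have hα : (univ : Finset α).Nonempty := hT.mono (subset_univ T)
  have row_le (i : κ) :
      𝔼 σ : Equiv.Perm α, (𝔼 a ∈ T, c i (σ a) - 𝔼 b, c i b) ^ 2 ≤ B ^ 2 / #T := by
    refine (expect_perm_expect_sub_expect_sq_le hT (c i)).trans ?_
    gcongr
    exact expect_le hα fun b _ => sq_le_sq.2 ((hc i b).trans (le_abs_self B))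
  refine (expect_le_sqrt_expect_sq _ _).trans ((Real.sqrt_le_left (by positivity)).2 ?_)
  rw [mul_pow, Real.sq_sqrt (by positivity)]
  simp only [Real.sq_sqrt (sum_nonneg fun _ _ => sq_nonneg _), expect_sum_comm]
  refine (sum_le_sum fun i _ => row_le i).trans_eq ?_
  rw [sum_const, card_univ, nsmul_eq_mul]
  ring

end UniformPermutation

namespace OnlineLP

open Finset
open scoped BigOperators

variable {m n : ℕ}

section ArrivalOrder

variable (σ : Equiv.Perm (Fin n)) (t : Fin n)

theorem apply_mem_revealed : σ t ∈ revealed σ t := by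
  simp [revealed]

theorem expect_revealed (f : Fin n → ℝ) :
    𝔼 j ∈ revealed σ t, f j = 𝔼 s ∈ Iic t, f (σ s) := by
  simp [revealed, expect_eq_sum_div_card]

variable {t} in
theorem revealed_mul_swap {r s : Fin n} (hr : r ≤ s) (ht : t ≤ s) :
    revealed (σ * Equiv.swap r t) s = revealed σ s := by
  have swap_Iic : (Iic s).map (Equiv.swap r t).toEmbedding = Iic s :=
    map_perm fun i hi => by
      rcases Equiv.swap_apply_ne_self_iff.1 hi with ⟨_, rfl | rfl⟩ <;> simpa
  exact (map_map _ _ _).symm.trans (congrArg (map σ.toEmbedding) swap_Iic)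

end ArrivalOrder

theorem expect_apply_eq_expect_revealed (t : Fin n) {G : Equiv.Perm (Fin n) → Fin n → ℝ}
    (hG : ∀ r ≤ t, ∀ σ, G (σ * Equiv.swap r t) = G σ) :
    𝔼 σ, G σ (σ t) = 𝔼 σ, 𝔼 j ∈ revealed σ t, G σ j := by
  simp only [expect_revealed]
  exact expect_perm_eq_expect_expect (mem_Iic.2 le_rfl) fun r hr => hG r (mem_Iic.1 hr)

theorem expect_mul_revealed_eq_zero_of_lt {U : Finset (Fin n) → Fin n → ℝ}
    (hU : ∀ S, 𝔼 j ∈ S, U S j = 0) {s t : Fin n} (hts : t < s) :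
    𝔼 σ, U (revealed σ s) (σ s) * U (revealed σ t) (σ t) = 0 := by
  rw [expect_apply_eq_expect_revealed t (G := fun σ j =>
    U (revealed σ s) (σ s) * U (revealed σ t) j) fun r hr σ => by
      simp only [revealed_mul_swap σ (hr.trans hts.le) hts.le, revealed_mul_swap σ hr le_rfl,
        Equiv.Perm.mul_apply, Equiv.swap_apply_of_ne_of_ne (hr.trans_lt hts).ne' hts.ne']]
  simp only [← mul_expect, hU, mul_zero, expect_const_zero]

theorem expect_mul_revealed_eq_zero {U : Finset (Fin n) → Fin n → ℝ}
    (hU : ∀ S, 𝔼 j ∈ S, U S j = 0) {s t : Fin n} (hst : s ≠ t) :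
    𝔼 σ, U (revealed σ s) (σ s) * U (revealed σ t) (σ t) = 0 := by
  rcases lt_or_gt_of_ne hst with h | h
  · simpa only [mul_comm] using expect_mul_revealed_eq_zero_of_lt hU h
  · exact expect_mul_revealed_eq_zero_of_lt hU h

section RunExpectation

variable (y : Finset (Fin n) → Fin n → ℝ)

theorem runExpect_prod (T : Finset (Fin n)) (g : Equiv.Perm (Fin n) → Fin n → Bool → ℝ) :
    runExpect y (fun σ x => ∏ t ∈ T, g σ t (x t)) =
      𝔼 σ, ∏ t ∈ T, (fraction y σ t * g σ t true + (1 - fraction y σ t) * g σ t false) := by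
  simp only [runExpect, runProb, mul_assoc, ← mul_sum, sum_bernoulli_mul_prod,
    Fintype.expect_eq_sum_div_card, div_eq_inv_mul]

theorem runExpect_eval (t : Fin n) (g : Equiv.Perm (Fin n) → Bool → ℝ) :
    runExpect y (fun σ x => g σ (x t)) =
      𝔼 σ, (fraction y σ t * g σ true + (1 - fraction y σ t) * g σ false) := by
  simpa only [prod_singleton] using runExpect_prod y {t} fun σ _ => g σ

theorem runExpect_sum {ι : Type*} (s : Finset ι)
    (f : ι → Equiv.Perm (Fin n) → (Fin n → Bool) → ℝ) :
    runExpect y (fun σ x => ∑ i ∈ s, f i σ x) = ∑ i ∈ s, runExpect y (f i) := by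
  simp only [runExpect, mul_sum]
  exact (sum_congr rfl fun σ _ => sum_comm).trans sum_comm

variable {y}

theorem runProb_nonneg (hy : ∀ S, ∀ j ∈ S, 0 ≤ y S j ∧ y S j ≤ 1) (σ : Equiv.Perm (Fin n))
    (x : Fin n → Bool) : 0 ≤ runProb y σ x := by
  refine mul_nonneg (by positivity) (prod_nonneg fun t _ => ?_)
  obtain ⟨h_nonneg, h_le_one⟩ := hy (revealed σ t) (σ t) (apply_mem_revealed σ t)
  split_ifs
  · exact h_nonneg
  · exact sub_nonneg.2 h_le_one

theorem runExpect_mono (hy : ∀ S, ∀ j ∈ S, 0 ≤ y S j ∧ y S j ≤ 1)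
    {f g : Equiv.Perm (Fin n) → (Fin n → Bool) → ℝ} (hfg : ∀ σ x, f σ x ≤ g σ x) :
    runExpect y f ≤ runExpect y g :=
  sum_le_sum fun σ _ => sum_le_sum fun x _ =>
    mul_le_mul_of_nonneg_left (hfg σ x) (runProb_nonneg hy σ x)

theorem runExpect_le_sqrt_runExpect_sq (hy : ∀ S, ∀ j ∈ S, 0 ≤ y S j ∧ y S j ≤ 1)
    (f : Equiv.Perm (Fin n) → (Fin n → Bool) → ℝ) :
    runExpect y f ≤ √(runExpect y fun σ x => f σ x ^ 2) := by
  have sum_runProb : ∑ z : Equiv.Perm (Fin n) × (Fin n → Bool), runProb y z.1 z.2 = 1 := by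
    simpa [runExpect, Fintype.sum_prod_type] using runExpect_prod y ∅ fun _ _ _ => 1
  simpa only [runExpect, Fintype.sum_prod_type] using sum_mul_le_sqrt_sum_mul_sq
    (fun z _ => runProb_nonneg hy z.1 z.2) sum_runProb fun z => f z.1 z.2

end RunExpectation

/-- The mean of `c j * y S j` over `j ∈ S`. When `y` selects fractional solutions, this is the
expected use of the resource with consumption rates `c` in the period after which `S` is the set of
revealed columns. -/
noncomputable def fractionalMean (c : Fin n → ℝ) (y : Finset (Fin n) → Fin n → ℝ)
    (S : Finset (Fin n)) : ℝ :=
  𝔼 j ∈ S, c j * y S j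

/-- The difference between the use `c (σ t) * bit b` of a resource at time `t` under the decision
`b` and its conditional mean given the set of revealed columns. -/
noncomputable def deviation (c : Fin n → ℝ) (y : Finset (Fin n) → Fin n → ℝ)
    (σ : Equiv.Perm (Fin n)) (t : Fin n) (b : Bool) : ℝ :=
  c (σ t) * bit b - fractionalMean c y (revealed σ t)

section Deviation

variable (c : Fin n → ℝ) (y : Finset (Fin n) → Fin n → ℝ)

theorem runExpect_sum_mul_bit :
    runExpect y (fun σ x => ∑ t, c (σ t) * bit (x t)) =
      ∑ t, 𝔼 σ, fractionalMean c y (revealed σ t) := by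
  rw [runExpect_sum]
  refine sum_congr rfl fun t _ => ?_
  calc runExpect y (fun σ x => c (σ t) * bit (x t))
      = 𝔼 σ, (fraction y σ t * (c (σ t) * bit true) +
          (1 - fraction y σ t) * (c (σ t) * bit false)) :=
        runExpect_eval y t fun σ b => c (σ t) * bit b
    _ = 𝔼 σ, c (σ t) * y (revealed σ t) (σ t) := by
        refine expect_congr rfl fun σ _ => ?_
        simp only [bit, fraction, if_true, Bool.false_eq_true, if_false]
        ring
    _ = 𝔼 σ, 𝔼 j ∈ revealed σ t, c j * y (revealed σ t) j :=
        expect_apply_eq_expect_revealed t (G := fun σ j => c j * y (revealed σ t) j)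
          fun r hr σ => by simp only [revealed_mul_swap σ hr le_rfl]

theorem runExpect_deviation_mul_deviation {s t : Fin n} (hst : s ≠ t) :
    runExpect y (fun σ x => deviation c y σ s (x s) * deviation c y σ t (x t)) = 0 := by
  have rounded_mean (σ : Equiv.Perm (Fin n)) (t : Fin n) :
      fraction y σ t * deviation c y σ t true + (1 - fraction y σ t) * deviation c y σ t false =
        c (σ t) * y (revealed σ t) (σ t) - fractionalMean c y (revealed σ t) := by
    simp only [deviation, fraction, bit, if_true, Bool.false_eq_true, if_false]
    ring
  have centered (S : Finset (Fin n)) : 𝔼 j ∈ S, (c j * y S j - fractionalMean c y S) = 0 := by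
    rcases S.eq_empty_or_nonempty with rfl | hS
    · exact expect_empty _
    · rw [expect_sub_distrib, expect_const hS, fractionalMean, sub_self]
  simpa only [prod_pair hst, rounded_mean, expect_mul_revealed_eq_zero centered hst] using
    runExpect_prod y {s, t} (deviation c y)

variable {c y}

theorem runExpect_deviation_sq_le (hy : ∀ S, ∀ j ∈ S, 0 ≤ y S j ∧ y S j ≤ 1) {B : ℝ}
    (hc : ∀ j, |c j| ≤ B) (t : Fin n) :
    runExpect y (fun σ x => deviation c y σ t (x t) ^ 2) ≤ B ^ 2 := by
  -- The variance of the column that arrives, plus the variance `c² y (1 - y)` of its rounding.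
  have mean_sq_le {S : Finset (Fin n)} (hS : S.Nonempty) :
      𝔼 j ∈ S, ((c j * y S j - fractionalMean c y S) ^ 2 + c j ^ 2 * (y S j * (1 - y S j))) ≤
        B ^ 2 := by
    calc _ ≤ 𝔼 j ∈ S, (c j * y S j) ^ 2 + 𝔼 j ∈ S, c j ^ 2 * (y S j * (1 - y S j)) := by
          rw [expect_add_distrib]
          exact add_le_add_left (expect_sub_expect_sq_le S _) _
      _ = 𝔼 j ∈ S, c j ^ 2 * y S j := by
          rw [← expect_add_distrib]
          exact expect_congr rfl fun j _ => by ring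
      _ ≤ B ^ 2 := expect_le hS fun j hj =>
          (mul_le_of_le_one_right (sq_nonneg _) (hy S j hj).2).trans
            (sq_le_sq.2 ((hc j).trans (le_abs_self B)))
  rw [runExpect_eval y t fun σ b => deviation c y σ t b ^ 2]
  calc 𝔼 σ, (fraction y σ t * deviation c y σ t true ^ 2 +
          (1 - fraction y σ t) * deviation c y σ t false ^ 2)
      = 𝔼 σ, ((c (σ t) * y (revealed σ t) (σ t) - fractionalMean c y (revealed σ t)) ^ 2 +
          c (σ t) ^ 2 * (y (revealed σ t) (σ t) * (1 - y (revealed σ t) (σ t)))) := by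
        refine expect_congr rfl fun σ _ => ?_
        simp only [deviation, fraction, bit, if_true, Bool.false_eq_true, if_false]
        ring
    _ = 𝔼 σ, 𝔼 j ∈ revealed σ t, ((c j * y (revealed σ t) j -
          fractionalMean c y (revealed σ t)) ^ 2 +
            c j ^ 2 * (y (revealed σ t) j * (1 - y (revealed σ t) j))) :=
        expect_apply_eq_expect_revealed t (G := fun σ j =>
          (c j * y (revealed σ t) j - fractionalMean c y (revealed σ t)) ^ 2 +
            c j ^ 2 * (y (revealed σ t) j * (1 - y (revealed σ t) j)))
          fun r hr σ => by simp only [revealed_mul_swap σ hr le_rfl]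
    _ ≤ B ^ 2 := expect_le univ_nonempty fun σ _ => mean_sq_le ⟨σ t, apply_mem_revealed σ t⟩

theorem runExpect_sum_deviation_sq_le (hy : ∀ S, ∀ j ∈ S, 0 ≤ y S j ∧ y S j ≤ 1) {B : ℝ}
    (hc : ∀ j, |c j| ≤ B) :
    runExpect y (fun σ x => (∑ t, deviation c y σ t (x t)) ^ 2) ≤ n * B ^ 2 := by
  simp only [sq (∑ _ : Fin n, _), sum_mul_sum, runExpect_sum]
  refine (sum_sum_le_sum_diag_of_offDiag_nonpos univ fun _ _ _ _ hst =>
    (runExpect_deviation_mul_deviation c y hst).le).trans ?_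
  simp only [← sq]
  refine (sum_le_sum fun t _ => runExpect_deviation_sq_le hy hc t).trans_eq ?_
  rw [sum_const, card_univ, Fintype.card_fin, nsmul_eq_mul]

end Deviation

section LinearProgram

variable {P : OnlineLP m n} {S : Finset (Fin n)} {x y : Fin n → ℝ}

theorem scaledFeasible_iff (hS : S.Nonempty) :
    P.ScaledFeasible S x ↔
      (∀ j ∈ S, 0 ≤ x j ∧ x j ≤ 1) ∧ ∀ i, 𝔼 j ∈ S, P.a j i * x j ≤ P.d i := by
  have hcard : (0 : ℝ) < #S := by exact_mod_cast hS.card_pos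
  simp only [ScaledFeasible, expect_eq_sum_div_card, div_le_iff₀' hcard]

theorem IsScaledOptimal.expect_mul_le (hy : P.IsScaledOptimal S y) (hx : P.ScaledFeasible S x) :
    𝔼 j ∈ S, P.r j * x j ≤ 𝔼 j ∈ S, P.r j * y j := by
  simp only [expect_eq_sum_div_card]
  exact div_le_div_of_nonneg_right (hy.2 x hx) (Nat.cast_nonneg _)

theorem scaledFeasible_smul {dlow z : ℝ} (hdlow : 0 < dlow) (hd : ∀ i, dlow ≤ P.d i)
    (hS : S.Nonempty) (hx : ∀ j ∈ S, 0 ≤ x j ∧ x j ≤ 1) (hz : 0 ≤ z)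
    (hxz : ∀ i, 𝔼 j ∈ S, P.a j i * x j ≤ P.d i + z) :
    P.ScaledFeasible S ((dlow / (dlow + z)) • x) := by
  have hdz : 0 < dlow + z := by positivity
  have hscale_le : dlow / (dlow + z) ≤ 1 := (div_le_one hdz).2 (le_add_of_nonneg_right hz)
  simp only [scaledFeasible_iff hS, Pi.smul_apply, smul_eq_mul, mul_left_comm, ← mul_expect]
  refine ⟨fun j hj => ⟨mul_nonneg (by positivity) (hx j hj).1,
    mul_le_one₀ hscale_le (hx j hj).1 (hx j hj).2⟩, fun i => ?_⟩
  calc dlow / (dlow + z) * 𝔼 j ∈ S, P.a j i * x j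
      ≤ dlow / (dlow + z) * (P.d i + z) := by gcongr; exact hxz i
    _ ≤ P.d i := by
        rw [div_mul_eq_mul_div, div_le_iff₀ hdz]
        nlinarith [mul_le_mul_of_nonneg_right (hd i) hz]

theorem IsScaledOptimal.expect_mul_le_add {rbar dlow z : ℝ} (hy : P.IsScaledOptimal S y)
    (hr : ∀ j, |P.r j| ≤ rbar) (hdlow : 0 < dlow) (hd : ∀ i, dlow ≤ P.d i) (hS : S.Nonempty)
    (hx : ∀ j ∈ S, 0 ≤ x j ∧ x j ≤ 1) (hz : 0 ≤ z)
    (hxz : ∀ i, 𝔼 j ∈ S, P.a j i * x j ≤ P.d i + z) :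
    𝔼 j ∈ S, P.r j * x j ≤ 𝔼 j ∈ S, P.r j * y j + rbar / dlow * z := by
  have hdz : 0 < dlow + z := by positivity
  have mean_le : 𝔼 j ∈ S, P.r j * x j ≤ rbar := expect_le hS fun j hj =>
    calc P.r j * x j ≤ |P.r j| * x j :=
          mul_le_mul_of_nonneg_right (le_abs_self _) (hx j hj).1
      _ ≤ |P.r j| := mul_le_of_le_one_right (abs_nonneg _) (hx j hj).2
      _ ≤ rbar := hr j
  have hrbar : 0 ≤ rbar := (abs_nonneg _).trans (hr hS.choose)
  have scaled_le : dlow / (dlow + z) * 𝔼 j ∈ S, P.r j * x j ≤ 𝔼 j ∈ S, P.r j * y j := by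
    simpa only [Pi.smul_apply, smul_eq_mul, mul_left_comm, ← mul_expect] using
      hy.expect_mul_le (scaledFeasible_smul hdlow hd hS hx hz hxz)
  have loss_le : z / (dlow + z) * 𝔼 j ∈ S, P.r j * x j ≤ rbar / dlow * z :=
    calc z / (dlow + z) * 𝔼 j ∈ S, P.r j * x j ≤ z / (dlow + z) * rbar := by gcongr
      _ ≤ z / dlow * rbar := by gcongr; exact le_add_of_nonneg_right hz
      _ = rbar / dlow * z := by ring
  have split : dlow / (dlow + z) + z / (dlow + z) = 1 := by
    rw [← add_div, div_self hdz.ne']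
  calc 𝔼 j ∈ S, P.r j * x j
      = dlow / (dlow + z) * 𝔼 j ∈ S, P.r j * x j + z / (dlow + z) * 𝔼 j ∈ S, P.r j * x j := by
        rw [← add_mul, split, one_mul]
    _ ≤ _ := add_le_add scaled_le loss_le

theorem mem_primalFeasible_iff : x ∈ P.primalFeasible ↔ P.ScaledFeasible univ x := by
  simp only [primalFeasible, ScaledFeasible, rhs, Set.mem_ofPred_eq, mem_univ, true_imp_iff,
    card_univ, Fintype.card_fin]

theorem IsScaledOptimal.primalValue_eq (hx : P.IsScaledOptimal univ x) :
    P.primalValue = ∑ j, P.r j * x j :=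
  IsGreatest.csSup_eq ⟨Set.mem_image_of_mem _ (mem_primalFeasible_iff.2 hx.1),
    Set.forall_mem_image.2 fun y hy => hx.2 y (mem_primalFeasible_iff.1 hy)⟩

end LinearProgram

section Performance

variable {P : OnlineLP m n} {sol : Finset (Fin n) → Fin n → ℝ} {rbar abar dlow : ℝ}

theorem IsSolver.expect_mul_le_expect_fractionalMean_add (hsol : P.IsSolver sol)
    (hr : ∀ j, |P.r j| ≤ rbar) (habar : 0 ≤ abar)
    (ha : ∀ j i, |P.a j i| ≤ abar) (hdlow : 0 < dlow) (hd : ∀ i, dlow ≤ P.d i)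
    {x : Fin n → ℝ} (hx : P.ScaledFeasible univ x) (t : Fin n) :
    𝔼 j, P.r j * x j ≤ 𝔼 σ, fractionalMean P.r sol (revealed σ t) +
      rbar / dlow * (abar * √(m / ((t : ℝ) + 1))) := by
  have hT : (Iic t).Nonempty := ⟨t, mem_Iic.2 le_rfl⟩
  have hx_univ := (scaledFeasible_iff ⟨t, mem_univ t⟩).1 hx
  have hrbar : 0 ≤ rbar := (abs_nonneg _).trans (hr t)
  set use : Fin m → Fin n → ℝ := fun i j => P.a j i * x j
  have use_le (i : Fin m) (j : Fin n) : |use i j| ≤ abar := by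
    obtain ⟨h_nonneg, h_le_one⟩ := hx_univ.1 j (mem_univ j)
    rw [abs_mul, abs_of_nonneg h_nonneg]
    exact (mul_le_of_le_one_right (abs_nonneg _) h_le_one).trans (ha j i)
  set overload : Equiv.Perm (Fin n) → ℝ := fun σ =>
    √(∑ i, (𝔼 s ∈ Iic t, use i (σ s) - 𝔼 j, use i j) ^ 2)
  have use_revealed_le (σ : Equiv.Perm (Fin n)) (i : Fin m) :
      𝔼 j ∈ revealed σ t, use i j ≤ P.d i + overload σ := by
    rw [expect_revealed]
    have excess_le : 𝔼 s ∈ Iic t, use i (σ s) - 𝔼 j, use i j ≤ overload σ :=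
      le_sqrt_sum_sq (mem_univ i) fun i => 𝔼 s ∈ Iic t, use i (σ s) - 𝔼 j, use i j
    linarith [hx_univ.2 i]
  calc 𝔼 j, P.r j * x j
      = 𝔼 σ, 𝔼 j ∈ revealed σ t, P.r j * x j := by
        simp only [expect_revealed]
        exact (expect_perm_expect hT fun j => P.r j * x j).symm
    _ ≤ 𝔼 σ, (fractionalMean P.r sol (revealed σ t) + rbar / dlow * overload σ) :=
        expect_le_expect fun σ _ => (hsol _).expect_mul_le_add hr hdlow hd
          ⟨σ t, apply_mem_revealed σ t⟩ (fun j _ => hx_univ.1 j (mem_univ j))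
          (Real.sqrt_nonneg _) (use_revealed_le σ)
    _ = 𝔼 σ, fractionalMean P.r sol (revealed σ t) + rbar / dlow * 𝔼 σ, overload σ := by
        rw [expect_add_distrib, mul_expect]
    _ ≤ _ := by
        gcongr
        simpa using expect_perm_sqrt_sum_sq_le habar use_le hT

theorem IsSolver.primalValue_sub_runExpect_reward_le (hsol : P.IsSolver sol)
    (hrbar : 0 ≤ rbar) (hr : ∀ j, |P.r j| ≤ rbar) (habar : 0 ≤ abar)
    (ha : ∀ j i, |P.a j i| ≤ abar) (hdlow : 0 < dlow) (hd : ∀ i, dlow ≤ P.d i) :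
    P.primalValue - runExpect sol P.reward ≤ 2 * (rbar * abar / dlow) * √((m : ℝ) * n) := by
  have value_eq : P.primalValue = ∑ _t : Fin n, 𝔼 j, P.r j * sol univ j := by
    rw [(hsol univ).primalValue_eq, sum_const, card_univ, Fintype.card_smul_expect]
  have reward_eq : runExpect sol P.reward =
      ∑ t, 𝔼 σ, fractionalMean P.r sol (revealed σ t) := runExpect_sum_mul_bit P.r sol
  have gap_le (t : Fin n) : 𝔼 j, P.r j * sol univ j - 𝔼 σ, fractionalMean P.r sol (revealed σ t) ≤
      rbar * abar / dlow * √m * (√((t : ℝ) + 1))⁻¹ :=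
    calc _ ≤ rbar / dlow * (abar * √(m / ((t : ℝ) + 1))) :=
          sub_le_iff_le_add'.2 (hsol.expect_mul_le_expect_fractionalMean_add
            hr habar ha hdlow hd (hsol univ).1 t)
      _ = _ := by rw [Real.sqrt_div (Nat.cast_nonneg m)]; ring
  calc P.primalValue - runExpect sol P.reward
      ≤ ∑ t : Fin n, rbar * abar / dlow * √m * (√((t : ℝ) + 1))⁻¹ := by
        rw [value_eq, reward_eq, ← sum_sub_distrib]
        exact sum_le_sum fun t _ => gap_le t
    _ ≤ rbar * abar / dlow * √m * (2 * √n) := by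
        rw [← mul_sum]
        gcongr
        exact sum_fin_inv_sqrt_le n
    _ = 2 * (rbar * abar / dlow) * √((m : ℝ) * n) := by
        rw [Real.sqrt_mul (Nat.cast_nonneg m)]
        ring

theorem IsSolver.violation_sq_le (hsol : P.IsSolver sol) (σ : Equiv.Perm (Fin n))
    (x : Fin n → Bool) :
    P.violation σ x ^ 2 ≤ ∑ i, (∑ t, deviation (fun j => P.a j i) sol σ t (x t)) ^ 2 := by
  simp only [violation, EuclideanSpace.norm_sq_eq, Real.norm_eq_abs, sq_abs]
  refine sum_le_sum fun i _ => ?_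
  have mean_le (t : Fin n) : fractionalMean (fun j => P.a j i) sol (revealed σ t) ≤ P.d i :=
    ((scaledFeasible_iff ⟨σ t, apply_mem_revealed σ t⟩).1 (hsol _).1).2 i
  have overuse_le : ∑ t, P.a (σ t) i * bit (x t) - P.rhs i ≤
      ∑ t, deviation (fun j => P.a j i) sol σ t (x t) := by
    have sum_mean_le := sum_le_sum fun t (_ : t ∈ univ) => mean_le t
    rw [sum_const, card_univ, Fintype.card_fin, nsmul_eq_mul] at sum_mean_le
    simp only [deviation, sum_sub_distrib, rhs]
    exact sub_le_sub_left sum_mean_le _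
  rw [sq_le_sq, abs_of_nonneg (le_max_right _ _)]
  exact max_le (overuse_le.trans (le_abs_self _)) (abs_nonneg _)

theorem IsSolver.runExpect_violation_le (hsol : P.IsSolver sol) (habar : 0 ≤ abar)
    (ha : ∀ j i, |P.a j i| ≤ abar) :
    runExpect sol P.violation ≤ abar * √((m : ℝ) * n) := by
  have hunit (S : Finset (Fin n)) : ∀ j ∈ S, 0 ≤ sol S j ∧ sol S j ≤ 1 := (hsol S).1.1
  calc runExpect sol P.violation
      ≤ √(runExpect sol fun σ x => P.violation σ x ^ 2) :=
        runExpect_le_sqrt_runExpect_sq hunit _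
    _ ≤ √(∑ i, runExpect sol fun σ x =>
          (∑ t, deviation (fun j => P.a j i) sol σ t (x t)) ^ 2) := by
        rw [← runExpect_sum]
        exact Real.sqrt_le_sqrt (runExpect_mono hunit hsol.violation_sq_le)
    _ ≤ √(∑ _i : Fin m, n * abar ^ 2) :=
        Real.sqrt_le_sqrt (sum_le_sum fun i _ =>
          runExpect_sum_deviation_sq_le hunit fun j => ha j i)
    _ = abar * √((m : ℝ) * n) := by
        rw [sum_const, card_univ, Fintype.card_fin, nsmul_eq_mul, ← mul_assoc,
          Real.sqrt_mul' _ (sq_nonneg _), Real.sqrt_sq habar, mul_comm]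

end Performance

end OnlineLP

theorem theorem5_general (rbar abar dlow : ℝ) (hdlow : 0 < dlow) :
    ∃ C : ℝ, 0 < C ∧
      ∀ {m n : ℕ} (P : OnlineLP m n), (∀ j, |P.r j| ≤ rbar) → (∀ j i, |P.a j i| ≤ abar) →
      (∀ i, dlow ≤ P.d i) →
      ∀ sol : Finset (Fin n) → Fin n → ℝ, P.IsSolver sol →
        P.primalValue - OnlineLP.runExpect sol P.reward ≤ C * √((m : ℝ) * n) ∧
        OnlineLP.runExpect sol P.violation ≤ C * √((m : ℝ) * n) := by
  have hregret : 0 ≤ 2 * (|rbar| * |abar| / dlow) := by positivity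
  refine ⟨2 * (|rbar| * |abar| / dlow) + |abar| + 1, by positivity,
    fun P hr ha hd sol hsol => ?_⟩
  have hr_abs : ∀ j, |P.r j| ≤ |rbar| := fun j => (hr j).trans (le_abs_self rbar)
  have ha_abs : ∀ j i, |P.a j i| ≤ |abar| := fun j i => (ha j i).trans (le_abs_self abar)
  constructor
  · refine (hsol.primalValue_sub_runExpect_reward_le (abs_nonneg rbar) hr_abs (abs_nonneg abar)
      ha_abs hdlow hd).trans ?_
    gcongr
    linarith [abs_nonneg abar]
  · refine (hsol.runExpect_violation_le (abs_nonneg abar) ha_abs).trans ?_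
    gcongr
    linarith

theorem theorem5 (rbar abar dlow dbar : ℝ) (hdlow : 0 < dlow) :
    ∃ C : ℝ, 0 < C ∧
      ∀ (m n : ℕ), 1 ≤ m → 1 ≤ n →
      ∀ P : OnlineLP m n, P.Bounded rbar abar dlow dbar → P.GeneralPosition →
      ∀ sol : Finset (Fin n) → Fin n → ℝ, P.IsSolver sol →
        P.primalValue - OnlineLP.runExpect sol P.reward
            ≤ C * Real.sqrt ((m : ℝ) * n) ∧
        (2 ≤ n → OnlineLP.runExpect sol P.violation
            ≤ C * (Real.sqrt ((m : ℝ) * n) * Real.log n)) := by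
  obtain ⟨C, hC, bounds⟩ := theorem5_general rbar abar dlow hdlow
  refine ⟨2 * C, by positivity, fun m n _ _ P hP _ sol hsol =>
    (bounds P hP.reward hP.column hP.d_lower sol hsol).imp
      (·.trans (by gcongr; linarith)) fun violation_le hn => ?_⟩
  exact violation_le.trans ((le_two_mul_mul_log (by positivity) (Nat.ofNat_le_cast.2 hn)).trans_eq
    (by ring))
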